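/- Let $(M,d)$ be a metric space. For $X,Y\subseteq M$ and $\alpha>0$ let $\mathscr{C}_Y(X,\alpha)$ be the (generalized) Čech complex: the abstract simplicial complex whose simplices are the nonempty finite subsets $\sigma\subseteq X$ for which there is $y\in Y$ with $d(x,y)<\alpha$ for all $x\in\sigma$. For an abstract simplicial complex $K$ let $|K|$ denote its geometric realization, with the weak topology (coherent with the closed simplices). **Theorem 3.1 (Dowker's Theorem for Čech complexes).** Let $0<\beta\le\alpha$ and $A\times B\subseteq X\times Y\subseteq M\times M$. Then there exist homotopy equivalences $$|\Gamma_{A,B}^{\beta}|:|\mathscr{C}_B(A,\beta)|\to|\mathscr{C}_A(B,\beta)|\quad\text{and}\quad |\Gamma_{X,Y}^{\alpha}|:|\mathscr{C}_Y(X,\alpha)|\to|\mathscr{C}_X(Y,\alpha)|$$ such that, with $\iota:|\mathscr{C}_B(A,\beta)|\hookrightarrow|\mathscr{C}_Y(X,\alpha)|$ and $\iota':|\mathscr{C}_A(B,\beta)|\hookrightarrow|\mathscr{C}_X(Y,\alpha)|$ the maps induced by the inclusions of simplicial complexes, the maps $\iota'\circ|\Gamma_{A,B}^{\beta}|$ and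 $|\Gamma_{X,Y}^{\alpha}|\circ\iota$ are homotopic. -/

import Mathlib

namespace PreAbstractSimplicialComplex

/-- The points of the geometric realization of an abstract simplicial complex `K`, in barycentric
coordinates: the functions from vertices to nonnegative reals whose support is a simplex of `K` and
whose values add up to one. -/
@[ext]
structure Realization {V : Type*} (K : PreAbstractSimplicialComplex V) where
  /-- the barycentric coordinates of the point -/
  weight : V →₀ ℝ
  weight_nonneg : ∀ v, 0 ≤ weight v
  support_mem : weight.support ∈ K.faces
  sum_weight : ∑ v ∈ weight.support, weight v = 1

namespace Realization

variable {V : Type*}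

/-- The closed simplex of the realization of `K` spanned by the vertices in `s`. -/
def closedSimplex (K : PreAbstractSimplicialComplex V) (s : Finset V) : Set K.Realization :=
  {p | p.weight.support ⊆ s}

/-- The Euclidean topology on a closed simplex: the one given by its finitely many barycentric
coordinates. -/
abbrev euclideanTopology (K : PreAbstractSimplicialComplex V) (s : Finset V) :
    TopologicalSpace (closedSimplex K s) :=
  TopologicalSpace.induced (fun p (v : s) => p.1.weight v) (inferInstance : TopologicalSpace (s → ℝ))

/-- The topology of the geometric realization is the weak topology (coherent with the closed
simplices): the finest one for which all inclusions of closed simplices `|s|`, for `s` in `K`,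
are continuous. -/
instance (K : PreAbstractSimplicialComplex V) : TopologicalSpace K.Realization :=
  ⨆ s : K.faces, TopologicalSpace.coinduced ((↑) : closedSimplex K s.1 → K.Realization)
    (euclideanTopology K s.1)

theorem isOpen_iff {K : PreAbstractSimplicialComplex V} {U : Set K.Realization} :
    IsOpen U ↔ ∀ s ∈ K.faces,
      @IsOpen _ (euclideanTopology K s) ((↑) ⁻¹' U : Set (closedSimplex K s)) := by
  rw [isOpen_iSup_iff]
  simp only [Subtype.forall]
  rfl

/-- The inclusion `|K| → |L|` of geometric realizations induced by the inclusion of a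
subcomplex `K` in `L`; barycentric coordinates are unchanged. -/
def inclusion {K L : PreAbstractSimplicialComplex V} (h : K ≤ L) :
    C(K.Realization, L.Realization) where
  toFun p := ⟨p.weight, p.weight_nonneg, h p.support_mem, p.sum_weight⟩
  continuous_toFun := by
    refine continuous_def.2 fun U hU => isOpen_iff.2 fun s hs => ?_
    obtain ⟨W, hW, hWU⟩ := isOpen_induced_iff.1 (isOpen_iff.1 hU s (h hs))
    refine isOpen_induced_iff.2 ⟨W, hW, ?_⟩
    ext p
    exact Set.ext_iff.1 hWU ⟨⟨p.1.weight, p.1.weight_nonneg, h p.1.support_mem, p.1.sum_weight⟩, p.2⟩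

end Realization

end PreAbstractSimplicialComplex

/-- The generalized Čech complex with vertices in `X`, witnesses in `Y` and radius `α`: a nonempty
finite subset `s` of `X` is a simplex when some point of `Y` is at distance less than `α` from
every point of `s`. -/
def cechComplex {M : Type*} [MetricSpace M] (Y X : Set M) (α : ℝ) :
    PreAbstractSimplicialComplex M where
  faces := {s | s.Nonempty ∧ (s : Set M) ⊆ X ∧ ∃ y ∈ Y, ∀ x ∈ s, dist x y < α}
  isRelLowerSet_faces := by
    rintro s ⟨hne, hX, y, hy, hd⟩
    exact ⟨hne, fun t hts ht => ⟨ht, fun x hx => hX (hts hx), y, hy, fun x hx => hd x (hts hx)⟩⟩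

theorem cechComplex_mono {M : Type*} [MetricSpace M] {A B X Y : Set M} {β α : ℝ}
    (hβα : β ≤ α) (h : A ×ˢ B ⊆ X ×ˢ Y) : cechComplex B A β ≤ cechComplex Y X α := by
  rintro s ⟨⟨x₀, hx₀⟩, hA, y, hy, hd⟩
  have key : ∀ x ∈ s, x ∈ X ∧ y ∈ Y := fun x hx => h (Set.mk_mem_prod (hA hx) hy)
  exact ⟨⟨x₀, hx₀⟩, fun x hx => (key x hx).1, y, (key x₀ hx₀).2,
    fun x hx => (hd x hx).trans_le hβα⟩

theorem cechComplex_mono_swap {M : Type*} [MetricSpace M] {A B X Y : Set M} {β α : ℝ}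
    (hβα : β ≤ α) (h : A ×ˢ B ⊆ X ×ˢ Y) : cechComplex A B β ≤ cechComplex X Y α :=
  cechComplex_mono hβα fun p hp => (h (show p.swap ∈ A ×ˢ B from ⟨hp.2, hp.1⟩)).symm

/-!
Both Čech complexes of a pair of subsets are Dowker complexes of one relation `R`, "the points are
close": `dowker R` on the one side, `dowker (flip R)` on the other. The proof is organized around
*Dowker maps* `f : |K| → |dowker (flip R)|`: the vertices at which the barycentric coordinates of `p`
are maximal are related to all vertices that carry `f p`. Such a vertex witnesses that the supports
of the images of `p` under two Dowker maps span a common face, so any two Dowker maps are homotopic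
along straight lines (`IsDowkerMap.homotopic`). For `R ≤ R'` both composites in the naturality square
are Dowker maps for `R'`, hence naturality needs no further argument.

Dowker maps exist: send `p` to the superlevel sets of its coordinates, which form a chain, that is,
to a point of the barycentric subdivision (`subdivide`), and then each face to a chosen common
relative (`dowkerMap`). A vertex of maximal weight lies in all superlevel sets, so it is related to
all the chosen relatives.

It remains to see that Dowker maps `f` and `g` in opposite directions satisfy `g ∘ f ≃ id`
(`IsDowkerMap.comp_homotopic_id`). All choices being homotopic, `f` and `g` may be picked at will. If
distinct faces had distinct chosen relatives, a set of such relatives would remember the faces it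
came from, and `g` could send it to a vertex lying in all of these faces; the support of `g (f p)`
would then be contained in that of `p`, and a straight line would join them. Distinctness is achieved
by replacing the second vertex set `W` by `Finset V × W` (`markedRel`), where a relative is marked by
the face for which it was chosen; forgetting the marks is a homotopy equivalence
(`mark_comp_unmark_homotopic_id`).

Continuity for the weak topology is always reduced to finitely many barycentric coordinates on one
closed simplex; for this all maps are required to be finitely carried (`IsCarried`).
-/

open Topology unitInterval NNReal

namespace PreAbstractSimplicialComplex

namespace Realization

variable {V W : Type*} {K : PreAbstractSimplicialComplex V} {L : PreAbstractSimplicialComplex W}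

/-! ### The weak topology -/

theorem weight_eq_zero {p : K.Realization} {s : Finset V} (hp : p ∈ closedSimplex K s) {v : V}
    (hv : v ∉ s) : p.weight v = 0 :=
  Finsupp.notMem_support_iff.1 fun h => hv (hp h)

theorem mem_closedSimplex_support (p : K.Realization) : p ∈ closedSimplex K p.weight.support :=
  Finset.Subset.refl _

theorem sum_weight_of_subset {p : K.Realization} {s : Finset V} (hp : p ∈ closedSimplex K s) :
    ∑ v ∈ s, p.weight v = 1 := by
  rw [← p.sum_weight]
  exact (Finset.sum_subset hp fun v _ hv => Finsupp.notMem_support_iff.1 hv).symm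

theorem support_nonempty (p : K.Realization) : p.weight.support.Nonempty :=
  (K.isRelLowerSet_faces p.support_mem).1

theorem continuous_weight (v : V) : Continuous fun p : K.Realization => p.weight v := by
  refine continuous_iSup_dom.2 fun s => continuous_coinduced_dom.2 ?_
  -- the Euclidean topology only mentions coordinates in `s`; all others vanish
  by_cases hv : v ∈ s.1
  · let := euclideanTopology K s.1
    have h : Continuous fun (p : closedSimplex K s.1) (v : s.1) => p.1.weight v :=
      continuous_induced_dom
    exact continuous_pi_iff.1 h ⟨v, hv⟩
  · have : (fun p : K.Realization => p.weight v) ∘ ((↑) : closedSimplex K s.1 → K.Realization)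
        = fun _ => 0 := funext fun p => weight_eq_zero p.2 hv
    rw [this]
    exact @continuous_const _ _ (euclideanTopology K s.1) _ _

theorem continuous_coe_euclidean {s : Finset V} (hs : s ∈ K.faces) :
    Continuous[euclideanTopology K s, _] ((↑) : closedSimplex K s → K.Realization) :=
  continuous_iff_coinduced_le.2
    (le_iSup (fun s : K.faces => TopologicalSpace.coinduced
      ((↑) : closedSimplex K s.1 → K.Realization) (euclideanTopology K s.1)) ⟨s, hs⟩)

/-- On a closed simplex, the weak topology restricts to the Euclidean topology. -/
theorem euclideanTopology_eq {s : Finset V} (hs : s ∈ K.faces) :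
    euclideanTopology K s = (instTopologicalSpaceSubtype : TopologicalSpace (closedSimplex K s)) := by
  refine le_antisymm (continuous_iff_le_induced.1 (continuous_coe_euclidean hs)) ?_
  exact continuous_iff_le_induced.1
    (continuous_pi fun v => (continuous_weight v.1).comp continuous_subtype_val)

theorem continuous_iff_continuousOn {Z : Type*} [TopologicalSpace Z] {f : K.Realization → Z} :
    Continuous f ↔ ∀ s ∈ K.faces, ContinuousOn f (closedSimplex K s) := by
  refine ⟨fun h s _ => h.continuousOn, fun h => ?_⟩
  refine continuous_iSup_dom.2 fun s => continuous_coinduced_dom.2 ?_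
  rw [euclideanTopology_eq s.2]
  exact continuousOn_iff_continuous_domRestrict.1 (h s.1 s.2)

/-- A map into a realization whose values lie in a finite subcomplex is continuous as soon as its
barycentric coordinates are: the closed simplices on a finite vertex set form a finite closed
cover. -/
theorem continuous_of_continuous_weight {Z : Type*} [TopologicalSpace Z] {f : Z → K.Realization}
    (s : Finset V) (hs : ∀ z, f z ∈ closedSimplex K s)
    (hf : ∀ v, Continuous fun z => (f z).weight v) : Continuous f := by
  let ι := {t : Finset V // t ⊆ s ∧ t ∈ K.faces}
  have : Finite ι := (s.powerset.finite_toSet.subset fun t ht => Finset.mem_powerset.2 ht.1 :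
    {t : Finset V | t ⊆ s ∧ t ∈ K.faces}.Finite)
  refine (locallyFinite_of_finite fun t : ι => f ⁻¹' closedSimplex K t.1).continuous ?_ ?_ ?_
  · refine Set.eq_univ_of_forall fun z => Set.mem_iUnion.2
      ⟨⟨(f z).weight.support, hs z, (f z).support_mem⟩, mem_closedSimplex_support _⟩
  · intro t
    have : f ⁻¹' closedSimplex K t.1 = ⋂ v ∉ t.1, {z | (f z).weight v = 0} := by
      ext z
      simp only [Set.mem_preimage, Set.mem_iInter, Set.mem_ofPred_eq]
      refine ⟨fun h v hv => weight_eq_zero h hv, fun h v hv => ?_⟩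
      by_contra hvt
      exact Finsupp.mem_support_iff.1 hv (h v hvt)
    rw [this]
    exact isClosed_biInter fun v _ => isClosed_eq (hf v) continuous_const
  · intro t
    rw [continuousOn_iff_continuous_domRestrict]
    let := euclideanTopology K t.1
    let g : f ⁻¹' closedSimplex K t.1 → closedSimplex K t.1 := fun z => ⟨f z.1, z.2⟩
    have hg : Continuous[_, euclideanTopology K t.1] g := continuous_induced_rng.2
      (continuous_pi fun v => (hf v).comp continuous_subtype_val)
    exact (continuous_coe_euclidean t.2.2).comp hg

/-- A map of realizations is finitely carried if it takes each closed simplex into a finite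
subcomplex. -/
def IsCarried (f : K.Realization → L.Realization) : Prop :=
  ∀ s ∈ K.faces, ∃ t : Finset W, ∀ p ∈ closedSimplex K s, f p ∈ closedSimplex L t

theorem IsCarried.comp {U : Type*} {J : PreAbstractSimplicialComplex U}
    {g : L.Realization → J.Realization} {f : K.Realization → L.Realization}
    (hg : IsCarried g) (hf : IsCarried f) : IsCarried (g ∘ f) := by
  classical
  intro s hs
  obtain ⟨t, ht⟩ := hf s hs
  choose! c hc using hg
  refine ⟨(t.powerset.filter (· ∈ L.faces)).biUnion c, fun p hp => ?_⟩
  refine (hc _ (f p).support_mem (f p) (mem_closedSimplex_support _)).trans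
    (Finset.subset_biUnion_of_mem c ?_)
  exact Finset.mem_filter.2 ⟨Finset.mem_powerset.2 (ht p hp), (f p).support_mem⟩

theorem isCarried_id : IsCarried (id : K.Realization → K.Realization) :=
  fun s _ => ⟨s, fun _ hp => hp⟩

theorem isCarried_inclusion {K' : PreAbstractSimplicialComplex V} (h : K ≤ K') :
    IsCarried (inclusion h) :=
  fun s _ => ⟨s, fun _ hp => hp⟩

/-- On each closed simplex, a finitely carried map is continuous if its coordinates are. -/
theorem IsCarried.continuous {f : K.Realization → L.Realization} (hf : IsCarried f)
    (hw : ∀ s ∈ K.faces, ∀ w, ContinuousOn (fun p => (f p).weight w) (closedSimplex K s)) :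
    Continuous f := by
  refine continuous_iff_continuousOn.2 fun s hs => ?_
  obtain ⟨t, ht⟩ := hf s hs
  exact continuousOn_iff_continuous_domRestrict.2 (continuous_of_continuous_weight t
    (fun p => ht p.1 p.2) fun w => continuousOn_iff_continuous_domRestrict.1 (hw s hs w))

/-! ### Straight-line homotopies -/

/-- The point of a realization with given weights, whose support need only be contained in some
face. -/
noncomputable def ofWeight (w : V →₀ ℝ) (h0 : ∀ v, 0 ≤ w v) (hw : ∃ s ∈ K.faces, w.support ⊆ s)
    (h1 : ∑ v ∈ w.support, w v = 1) : K.Realization where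
  weight := w
  weight_nonneg := h0
  support_mem := by
    obtain ⟨s, hs, hws⟩ := hw
    refine (K.isRelLowerSet_faces hs).2 hws (Finset.nonempty_iff_ne_empty.2 fun h => ?_)
    simp [h] at h1
  sum_weight := h1

/-- The point `(1 - t) p + t q` on the segment between two points of a common closed simplex. -/
noncomputable def segment (p q : K.Realization)
    (h : ∃ s ∈ K.faces, p ∈ closedSimplex K s ∧ q ∈ closedSimplex K s)
    (t : I) : K.Realization :=
  have hsupp {s : Finset V} (hp : p ∈ closedSimplex K s) (hq : q ∈ closedSimplex K s) :
      ((1 - (t : ℝ)) • p.weight + (t : ℝ) • q.weight).support ⊆ s := by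
    intro v hv
    by_contra hvs
    simp [weight_eq_zero hp hvs, weight_eq_zero hq hvs] at hv
  ofWeight ((1 - (t : ℝ)) • p.weight + (t : ℝ) • q.weight)
    (fun v => by
      have := mul_nonneg (sub_nonneg.2 t.2.2) (p.weight_nonneg v)
      have := mul_nonneg t.2.1 (q.weight_nonneg v)
      simp only [Finsupp.add_apply, Finsupp.smul_apply, smul_eq_mul]
      positivity)
    (h.imp fun s hs => ⟨hs.1, hsupp hs.2.1 hs.2.2⟩)
    (by
      obtain ⟨s, -, hp, hq⟩ := h
      rw [Finset.sum_subset (hsupp hp hq) fun v _ hv => Finsupp.notMem_support_iff.1 hv]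
      simp only [Finsupp.add_apply, Finsupp.smul_apply, smul_eq_mul, Finset.sum_add_distrib,
        ← Finset.mul_sum, sum_weight_of_subset hp, sum_weight_of_subset hq]
      ring)

theorem segment_weight (p q : K.Realization) (h) (t : I) (v : V) :
    (segment p q h t).weight v = (1 - (t : ℝ)) * p.weight v + t * q.weight v := by
  simp [segment, ofWeight]

attribute [irreducible] segment

theorem segment_mem_closedSimplex {p q : K.Realization} (h) (t : I) {s : Finset V}
    (hp : p ∈ closedSimplex K s) (hq : q ∈ closedSimplex K s) :
    segment p q h t ∈ closedSimplex K s := by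
  intro v hv
  by_contra hvs
  simp [segment_weight, weight_eq_zero hp hvs, weight_eq_zero hq hvs] at hv

theorem ext_weight {p q : K.Realization} (h : ∀ v, p.weight v = q.weight v) : p = q :=
  Realization.ext (Finsupp.ext h)

/-- Two finitely carried maps that take each point into a common closed simplex are homotopic
along straight lines. Continuity is checked after currying, because a map from `|K|` to a space of
paths can be tested on the closed simplices of `K`. -/
theorem homotopic_of_common_face {f g : C(K.Realization, L.Realization)} (hf : IsCarried f)
    (hg : IsCarried g)
    (h : ∀ p, ∃ s ∈ L.faces, f p ∈ closedSimplex L s ∧ g p ∈ closedSimplex L s) :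
    f.Homotopic g := by
  classical
  have hF (s) (hs : s ∈ K.faces) : Continuous fun x : closedSimplex K s × I =>
      segment (f x.1) (g x.1) (h x.1) x.2 := by
    obtain ⟨a, ha⟩ := hf s hs
    obtain ⟨b, hb⟩ := hg s hs
    refine continuous_of_continuous_weight (a ∪ b) (fun x => segment_mem_closedSimplex _ _
      ((ha _ x.1.2).trans Finset.subset_union_left)
      ((hb _ x.1.2).trans Finset.subset_union_right)) fun v => ?_
    simp only [segment_weight]
    have hfv : Continuous fun x : closedSimplex K s × I => (f x.1).weight v :=
      (continuous_weight v).comp (f.continuous.comp (by fun_prop))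
    have hgv : Continuous fun x : closedSimplex K s × I => (g x.1).weight v :=
      (continuous_weight v).comp (g.continuous.comp (by fun_prop))
    fun_prop
  have hpath (p : K.Realization) : Continuous fun t : I => segment (f p) (g p) (h p) t :=
    (hF _ p.support_mem).comp
      (Continuous.prodMk_right (⟨p, mem_closedSimplex_support p⟩ : closedSimplex K _))
  let G : K.Realization → C(I, L.Realization) := fun p => ⟨_, hpath p⟩
  have hG : Continuous G := continuous_iff_continuousOn.2 fun s hs =>
    continuousOn_iff_continuous_domRestrict.2
      (ContinuousMap.continuous_of_continuous_uncurry _ (hF s hs))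
  refine ⟨⟨⟨fun x => G x.2 x.1, ?_⟩, fun p => ?_, fun p => ?_⟩⟩
  · exact (ContinuousMap.continuous_uncurry_of_continuous ⟨G, hG⟩).comp continuous_swap
  · exact ext_weight fun v => by simp [G, segment_weight]
  · exact ext_weight fun v => by simp [G, segment_weight]

/-! ### Simplicial maps -/

theorem mapDomain_apply_eq_sum_filter [DecidableEq W] (φ : V → W) (x : V →₀ ℝ) {s : Finset V}
    (hs : x.support ⊆ s) (w : W) : x.mapDomain φ w = ∑ v ∈ s with φ v = w, x v := by
  rw [Finsupp.mapDomain, Finsupp.sum, Finsupp.finsetSum_apply, Finset.sum_filter]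
  simp only [Finsupp.single_apply]
  refine Finset.sum_subset hs fun v _ hv => ?_
  simp [Finsupp.notMem_support_iff.1 hv]

/-- The map of realizations induced by a vertex map that takes faces into faces. -/
noncomputable def mapVertices (φ : V → W) (h : ∀ s ∈ K.faces, ∃ t ∈ L.faces, ∀ v ∈ s, φ v ∈ t)
    (p : K.Realization) : L.Realization :=
  ofWeight (p.weight.mapDomain φ)
    (fun w => by
      classical
      rw [mapDomain_apply_eq_sum_filter φ _ (Finset.Subset.refl _)]
      exact Finset.sum_nonneg fun v _ => p.weight_nonneg v)
    (by
      classical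
      obtain ⟨t, ht, hpt⟩ := h _ p.support_mem
      exact ⟨t, ht, Finsupp.mapDomain_support.trans (Finset.image_subset_iff.2 hpt)⟩)
    (by
      have := Finsupp.sum_mapDomain_index (s := p.weight) (f := φ) (h := fun _ (a : ℝ) => a)
        (fun _ => rfl) (fun _ _ _ => rfl)
      exact this.trans p.sum_weight)

theorem mapVertices_mem_closedSimplex [DecidableEq W] {φ : V → W} (h) (p : K.Realization)
    {s : Finset V} (hp : p ∈ closedSimplex K s) :
    (mapVertices φ h p : L.Realization) ∈ closedSimplex L (s.image φ) :=
  Finsupp.mapDomain_support.trans (Finset.image_subset_image hp)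

theorem isCarried_mapVertices {φ : V → W} (h) :
    IsCarried (mapVertices φ h : K.Realization → L.Realization) := by
  classical
  exact fun s _ => ⟨s.image φ, fun p hp => mapVertices_mem_closedSimplex h p hp⟩

theorem continuous_mapVertices {φ : V → W} (h) :
    Continuous (mapVertices φ h : K.Realization → L.Realization) := by
  classical
  refine (isCarried_mapVertices h).continuous fun s hs w => ?_
  have hsum : Continuous fun p : K.Realization => ∑ v ∈ s with φ v = w, p.weight v :=
    continuous_finsetSum _ fun v _ => continuous_weight v
  exact hsum.continuousOn.congr fun p hp => mapDomain_apply_eq_sum_filter φ _ hp w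

/-! ### Barycentric subdivision -/

/-- The barycentric subdivision: its vertices are the faces of `K`, its faces the nonempty finite
chains of faces of `K`. -/
def subdivision (K : PreAbstractSimplicialComplex V) :
    PreAbstractSimplicialComplex (Finset V) where
  faces := {C | C.Nonempty ∧ (∀ s ∈ C, s ∈ K.faces) ∧ IsChain (· ⊆ ·) (C : Set (Finset V))}
  isRelLowerSet_faces := by
    rintro C ⟨hne, hK, hC⟩
    exact ⟨hne, fun D hDC hD => ⟨hD, fun s hs => hK s (hDC hs), hC.mono (Finset.coe_subset.2 hDC)⟩⟩

/-- A finite nonempty chain of faces has a smallest one, and any of its vertices lies in all of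
them. -/
theorem exists_forall_mem_of_mem_subdivision {C : Finset (Finset V)}
    (hC : C ∈ (subdivision K).faces) : ∃ v, ∀ t ∈ C, v ∈ t := by
  obtain ⟨hne, hK, hchain⟩ := hC
  obtain ⟨s, hs⟩ := C.exists_minimal hne
  obtain ⟨v, hv⟩ := (K.isRelLowerSet_faces (hK s hs.prop)).1
  refine ⟨v, fun t ht => ?_⟩
  rcases hchain.total hs.prop ht with h | h
  · exact h hv
  · exact hs.le_of_le ht h hv

/-- The barycentric coordinates of a point, as nonnegative reals. -/
def nnweight (p : K.Realization) (v : V) : ℝ≥0 := ⟨p.weight v, p.weight_nonneg v⟩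

theorem nnweight_eq_zero {p : K.Realization} {v : V} :
    nnweight p v = 0 ↔ v ∉ p.weight.support := by
  rw [Finsupp.notMem_support_iff, ← NNReal.coe_eq_zero]; rfl

theorem continuous_nnweight (v : V) : Continuous fun p : K.Realization => nnweight p v :=
  (continuous_weight v).subtype_mk _

open Classical in
/-- A continuous function of `p` that is positive exactly when the nonempty set `τ` is a
superlevel set `{v | c ≤ p v}` of the barycentric coordinates of `p` with `c > 0`. The subtraction
is the truncated one of `ℝ≥0`. -/
noncomputable def levelGap (p : K.Realization) (τ : Finset V) : ℝ≥0 :=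
  if τ.Nonempty then ∏ v ∈ τ, (nnweight p v - (p.weight.support \ τ).sup (nnweight p)) else 0

/-- In the definition of the level gap, the support can be replaced by any larger set; for points of
one closed simplex it can thus be taken to be constant. -/
theorem levelGap_eq [DecidableEq V] {p : K.Realization} {s : Finset V} (hp : p ∈ closedSimplex K s)
    (τ : Finset V) : levelGap p τ =
      if τ.Nonempty then ∏ v ∈ τ, (nnweight p v - (s \ τ).sup (nnweight p)) else 0 := by
  -- vertices outside the support have weight `0`, which does not affect a supremum in `ℝ≥0`
  have : (p.weight.support \ τ).sup (nnweight p) = (s \ τ).sup (nnweight p) := by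
    refine le_antisymm (Finset.sup_mono (Finset.sdiff_subset_sdiff hp (Finset.Subset.refl τ)))
      (Finset.sup_le fun v hv => ?_)
    by_cases hvp : v ∈ p.weight.support
    · exact Finset.le_sup (Finset.mem_sdiff.2 ⟨hvp, (Finset.mem_sdiff.1 hv).2⟩)
    · rw [nnweight_eq_zero.2 hvp]; exact zero_le
  rw [← this]
  unfold levelGap
  congr!

theorem continuousOn_levelGap (s τ : Finset V) :
    ContinuousOn (fun p : K.Realization => levelGap p τ) (closedSimplex K s) := by
  classical
  refine ContinuousOn.congr (Continuous.continuousOn ?_) fun p hp => levelGap_eq hp τ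
  split_ifs
  · exact continuous_finsetProd _ fun v _ => (continuous_nnweight v).sub
      (Continuous.finset_sup_apply fun v _ => continuous_nnweight v)
  · exact continuous_const

theorem lt_of_levelGap_ne_zero {p : K.Realization} {τ : Finset V} (h : levelGap p τ ≠ 0) {v w : V}
    (hv : v ∈ τ) (hw : w ∉ τ) : p.weight w < p.weight v := by
  classical
  rw [levelGap_eq (mem_closedSimplex_support p), if_pos ⟨v, hv⟩, Finset.prod_ne_zero_iff] at h
  have hlt := tsub_pos_iff_lt.1 (pos_iff_ne_zero.2 (h v hv))
  change nnweight p w < nnweight p v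
  by_cases hwp : w ∈ p.weight.support
  · exact (Finset.le_sup (Finset.mem_sdiff.2 ⟨hwp, hw⟩)).trans_lt hlt
  · rw [nnweight_eq_zero.2 hwp]; exact pos_of_gt hlt

theorem subset_support_of_levelGap_ne_zero {p : K.Realization} {τ : Finset V}
    (h : levelGap p τ ≠ 0) : τ ⊆ p.weight.support := by
  classical
  intro v hv
  by_contra hvp
  rw [levelGap_eq (mem_closedSimplex_support p), if_pos ⟨v, hv⟩, Finset.prod_ne_zero_iff] at h
  exact h v hv (by rw [nnweight_eq_zero.2 hvp]; exact zero_tsub _)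

theorem nonempty_of_levelGap_ne_zero {p : K.Realization} {τ : Finset V} (h : levelGap p τ ≠ 0) :
    τ.Nonempty := by
  by_contra hτ
  simp [levelGap, hτ] at h

theorem subset_or_subset_of_levelGap_ne_zero {p : K.Realization} {ρ τ : Finset V}
    (hρ : levelGap p ρ ≠ 0) (hτ : levelGap p τ ≠ 0) : ρ ⊆ τ ∨ τ ⊆ ρ := by
  by_contra! h
  obtain ⟨v, hv, hv'⟩ := Finset.not_subset.1 h.1
  obtain ⟨w, hw, hw'⟩ := Finset.not_subset.1 h.2
  exact lt_asymm (lt_of_levelGap_ne_zero hρ hv hw') (lt_of_levelGap_ne_zero hτ hw hv')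

theorem levelGap_support_ne_zero (p : K.Realization) : levelGap p p.weight.support ≠ 0 := by
  classical
  rw [levelGap_eq (mem_closedSimplex_support p), if_pos p.support_nonempty, Finset.prod_ne_zero_iff]
  intro v hv
  rw [Finset.sdiff_self, Finset.sup_empty, bot_eq_zero, tsub_zero]
  exact fun h => nnweight_eq_zero.1 h hv

/-- The sum of all level gaps of a point, by which they are normalized. -/
noncomputable def totalGap (p : K.Realization) : ℝ≥0 :=
  ∑ τ ∈ p.weight.support.powerset, levelGap p τ

theorem totalGap_ne_zero (p : K.Realization) : totalGap p ≠ 0 := fun h =>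
  levelGap_support_ne_zero p (Finset.sum_eq_zero_iff.1 h _ (Finset.mem_powerset_self _))

theorem continuousOn_totalGap (s : Finset V) :
    ContinuousOn (totalGap : K.Realization → ℝ≥0) (closedSimplex K s) := by
  refine ContinuousOn.congr (f := fun p => ∑ τ ∈ s.powerset, levelGap p τ)
    (continuousOn_finsetSum _ fun τ _ => continuousOn_levelGap s τ) fun p hp => ?_
  refine Finset.sum_subset (Finset.powerset_mono.2 hp) fun τ _ hτ => ?_
  by_contra h
  exact hτ (Finset.mem_powerset.2 (subset_support_of_levelGap_ne_zero h))

/-- The weights of the image of a point in the barycentric subdivision. -/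
noncomputable def subdivideWeight (p : K.Realization) : Finset V →₀ ℝ :=
  Finsupp.onFinset p.weight.support.powerset
    (fun τ => ((levelGap p τ / totalGap p : ℝ≥0) : ℝ)) fun τ h =>
      Finset.mem_powerset.2 (subset_support_of_levelGap_ne_zero fun h0 => h (by simp [h0]))

theorem levelGap_ne_zero_of_mem {p : K.Realization} {τ : Finset V}
    (h : τ ∈ (subdivideWeight p).support) : levelGap p τ ≠ 0 := fun h0 =>
  Finsupp.mem_support_iff.1 h (by simp [subdivideWeight, h0])

/-- The map from `|K|` to the realization of the barycentric subdivision that takes a point to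
the normalized combination of its superlevel sets, weighted by their level gaps. It differs from the
usual homeomorphism, but only by moving points within the open simplices of the subdivision. -/
noncomputable def subdivide (p : K.Realization) : (subdivision K).Realization where
  weight := subdivideWeight p
  weight_nonneg _ := NNReal.coe_nonneg _
  support_mem := by
    refine ⟨?_, fun τ hτ => ?_, fun ρ hρ τ hτ _ => ?_⟩
    · refine ⟨p.weight.support, Finsupp.mem_support_iff.2 ?_⟩
      exact NNReal.coe_ne_zero.2 (div_ne_zero (levelGap_support_ne_zero p) (totalGap_ne_zero p))
    · have h := levelGap_ne_zero_of_mem hτ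
      exact (K.isRelLowerSet_faces p.support_mem).2 (subset_support_of_levelGap_ne_zero h)
        (nonempty_of_levelGap_ne_zero h)
    · exact subset_or_subset_of_levelGap_ne_zero (levelGap_ne_zero_of_mem hρ)
        (levelGap_ne_zero_of_mem hτ)
  sum_weight := by
    have h : (subdivideWeight p).support ⊆ p.weight.support.powerset :=
      Finsupp.support_onFinset_subset
    rw [Finset.sum_subset h fun τ _ hτ => Finsupp.notMem_support_iff.1 hτ]
    simp only [subdivideWeight, Finsupp.onFinset_apply]
    rw [← NNReal.coe_sum, ← Finset.sum_div]
    exact congrArg NNReal.toReal (div_self (totalGap_ne_zero p))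

theorem subset_support_of_mem_subdivide {p : K.Realization} {τ : Finset V}
    (h : τ ∈ (subdivide p).weight.support) : τ ⊆ p.weight.support :=
  subset_support_of_levelGap_ne_zero (levelGap_ne_zero_of_mem h)

/-- A vertex of maximal weight lies in every superlevel set. -/
theorem mem_of_mem_subdivide {p : K.Realization} {τ : Finset V}
    (h : τ ∈ (subdivide p).weight.support) {v : V} (hv : ∀ w, p.weight w ≤ p.weight v) :
    v ∈ τ := by
  by_contra hvτ
  have h0 := levelGap_ne_zero_of_mem h
  obtain ⟨w, hw⟩ := nonempty_of_levelGap_ne_zero h0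
  exact (hv w).not_gt (lt_of_levelGap_ne_zero h0 hw hvτ)

theorem isCarried_subdivide : IsCarried (subdivide : K.Realization → _) :=
  fun s _ => ⟨s.powerset, fun _ hp _ hτ =>
    Finset.mem_powerset.2 ((subset_support_of_mem_subdivide hτ).trans hp)⟩

theorem continuous_subdivide : Continuous (subdivide : K.Realization → _) := by
  refine isCarried_subdivide.continuous fun s _ τ => ?_
  exact NNReal.continuous_coe.comp_continuousOn
    ((continuousOn_levelGap s τ).div (continuousOn_totalGap s) fun p _ => totalGap_ne_zero p)

theorem exists_forall_weight_le (p : K.Realization) :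
    ∃ v ∈ p.weight.support, ∀ w, p.weight w ≤ p.weight v := by
  obtain ⟨v, hv, hmax⟩ := p.weight.support.exists_max_image p.weight p.support_nonempty
  refine ⟨v, hv, fun w => ?_⟩
  by_cases hw : w ∈ p.weight.support
  · exact hmax w hw
  · rw [Finsupp.notMem_support_iff.1 hw]; exact p.weight_nonneg v

end Realization

/-! ### Dowker complexes and Dowker maps -/

/-- The Dowker complex of a relation: a nonempty finite set of vertices is a face when its elements
are all related to a common `w`. -/
def dowker {V W : Type*} (R : V → W → Prop) : PreAbstractSimplicialComplex V where
  faces := {s | s.Nonempty ∧ ∃ w, ∀ v ∈ s, R v w}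
  isRelLowerSet_faces := fun _ h => ⟨h.1, fun _ hts ht =>
    ⟨ht, h.2.imp fun _ hw v hv => hw v (hts hv)⟩⟩

open Realization

variable {V W : Type*} {R : V → W → Prop}

/-- A Dowker map for `R` is a finitely carried map to the realization of the Dowker complex of the
transposed relation, such that the vertices of maximal weight of a point are related to all
vertices that carry its image. -/
structure IsDowkerMap {K : PreAbstractSimplicialComplex V} (R : V → W → Prop)
    (f : K.Realization → (dowker (flip R)).Realization) : Prop where
  isCarried : IsCarried f
  rel : ∀ p v w, (∀ u, p.weight u ≤ p.weight v) → w ∈ (f p).weight.support → R v w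

/-- Any two Dowker maps are homotopic: a vertex of maximal weight is related to all vertices that
carry one of the two images. -/
theorem IsDowkerMap.homotopic {K : PreAbstractSimplicialComplex V}
    {f g : C(K.Realization, (dowker (flip R)).Realization)}
    (hf : IsDowkerMap R f) (hg : IsDowkerMap R g) : f.Homotopic g := by
  classical
  refine homotopic_of_common_face hf.isCarried hg.isCarried fun p => ?_
  obtain ⟨v, -, hv⟩ := exists_forall_weight_le p
  refine ⟨(f p).weight.support ∪ (g p).weight.support, ⟨?_, v, fun w hw => ?_⟩,
    Finset.subset_union_left, Finset.subset_union_right⟩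
  · exact (f p).support_nonempty.mono Finset.subset_union_left
  · exact (Finset.mem_union.1 hw).elim (hf.rel p v w hv) (hg.rel p v w hv)

/-- A choice `φ` of a common relative for each face is a simplicial map on the barycentric
subdivision: the relatives of the faces of a chain are all related to the vertices of its smallest
face. -/
theorem exists_face_of_subdivision {K : PreAbstractSimplicialComplex V} {φ : Finset V → W}
    (hφ : ∀ s ∈ K.faces, ∀ v ∈ s, R v (φ s)) :
    ∀ C ∈ (subdivision K).faces, ∃ t ∈ (dowker (flip R)).faces, ∀ s ∈ C, φ s ∈ t := by
  classical
  intro C hC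
  obtain ⟨v, hv⟩ := exists_forall_mem_of_mem_subdivision hC
  refine ⟨C.image φ, ⟨hC.1.image φ, v, fun w hw => ?_⟩, fun s hs => Finset.mem_image_of_mem φ hs⟩
  obtain ⟨s, hs, rfl⟩ := Finset.mem_image.1 hw
  exact hφ s (hC.2.1 s hs) v (hv s hs)

/-- The composite of `subdivide` with the simplicial map of a choice of common relatives. -/
noncomputable def dowkerMap {K : PreAbstractSimplicialComplex V} (φ : Finset V → W)
    (hφ : ∀ s ∈ K.faces, ∀ v ∈ s, R v (φ s)) :
    C(K.Realization, (dowker (flip R)).Realization) :=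
  ⟨mapVertices φ (exists_face_of_subdivision hφ) ∘ subdivide,
    (continuous_mapVertices _).comp continuous_subdivide⟩

section

variable {K : PreAbstractSimplicialComplex V} {φ : Finset V → W}
  (hφ : ∀ s ∈ K.faces, ∀ v ∈ s, R v (φ s))

theorem exists_of_mem_support_dowkerMap {p : K.Realization} {w : W}
    (hw : w ∈ (dowkerMap φ hφ p).weight.support) :
    ∃ τ ∈ (subdivide p).weight.support, φ τ = w := by
  classical
  exact Finset.mem_image.1 (mapVertices_mem_closedSimplex (exists_face_of_subdivision hφ) _
    (mem_closedSimplex_support (subdivide p)) hw)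

theorem isDowkerMap_dowkerMap : IsDowkerMap R (dowkerMap φ hφ) where
  isCarried := (isCarried_mapVertices (exists_face_of_subdivision hφ)).comp isCarried_subdivide
  rel p v w hv hw := by
    obtain ⟨τ, hτ, rfl⟩ := exists_of_mem_support_dowkerMap hφ hw
    exact hφ τ ((subdivide p).support_mem.2.1 τ hτ) v (mem_of_mem_subdivide hτ hv)

end

theorem exists_isDowkerMap (R : V → W → Prop) :
    ∃ f : C((dowker R).Realization, (dowker (flip R)).Realization), IsDowkerMap R f := by
  rcases isEmpty_or_nonempty (dowker R).Realization with h | ⟨⟨p⟩⟩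
  · exact ⟨⟨isEmptyElim, continuous_iff_continuousAt.2 isEmptyElim⟩,
      fun _ _ => ⟨∅, fun p => isEmptyElim p⟩, fun p => isEmptyElim p⟩
  · have : Nonempty W := p.support_mem.2.nonempty
    have h : ∀ s, s ∈ (dowker R).faces → ∃ w, ∀ v ∈ s, R v w := fun s hs => hs.2
    choose! φ hφ using h
    exact ⟨dowkerMap φ hφ, isDowkerMap_dowkerMap hφ⟩

/-! ### Marked vertices and homotopy inverses -/

/-- The relation with the second vertex set enlarged to `Finset V × W`, so that the common relatives
of distinct faces can be chosen to be distinct. -/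
def markedRel (R : V → W → Prop) (v : V) (x : Finset V × W) : Prop := R v x.2

theorem dowker_markedRel_le (R : V → W → Prop) : dowker (markedRel R) ≤ dowker R :=
  fun _ hs => ⟨hs.1, hs.2.imp' Prod.snd fun _ h => h⟩

theorem exists_face_snd (R : V → W → Prop) :
    ∀ C ∈ (dowker (flip (markedRel R))).faces, ∃ t ∈ (dowker (flip R)).faces,
      ∀ x ∈ C, x.2 ∈ t := by
  classical
  refine fun C hC => ⟨C.image Prod.snd, ⟨hC.1.image _, hC.2.imp fun v hv w hw => ?_⟩,
    fun x hx => Finset.mem_image_of_mem _ hx⟩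
  obtain ⟨x, hx, rfl⟩ := Finset.mem_image.1 hw
  exact hv x hx

theorem exists_face_mk_empty (R : V → W → Prop) :
    ∀ s ∈ (dowker (flip R)).faces, ∃ t ∈ (dowker (flip (markedRel R))).faces,
      ∀ w ∈ s, ((∅, w) : Finset V × W) ∈ t := by
  classical
  refine fun s hs => ⟨s.image (Prod.mk ∅), ⟨hs.1.image _, hs.2.imp fun v hv x hx => ?_⟩,
    fun x hx => Finset.mem_image_of_mem _ hx⟩
  obtain ⟨w, hw, rfl⟩ := Finset.mem_image.1 hx
  exact hv w hw

/-- Forgetting the marks. -/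
noncomputable def unmark (R : V → W → Prop) :
    C((dowker (flip (markedRel R))).Realization, (dowker (flip R)).Realization) :=
  ⟨mapVertices Prod.snd (exists_face_snd R), continuous_mapVertices _⟩

/-- Marking all vertices by the empty set. -/
noncomputable def mark (R : V → W → Prop) :
    C((dowker (flip R)).Realization, (dowker (flip (markedRel R))).Realization) :=
  ⟨mapVertices (Prod.mk ∅) (exists_face_mk_empty R), continuous_mapVertices _⟩

theorem isCarried_unmark (R : V → W → Prop) : IsCarried (unmark R) :=
  isCarried_mapVertices (exists_face_snd R)

theorem isCarried_mark (R : V → W → Prop) : IsCarried (mark R) :=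
  isCarried_mapVertices (exists_face_mk_empty R)

theorem exists_of_mem_support_unmark {p : (dowker (flip (markedRel R))).Realization} {w : W}
    (hw : w ∈ (unmark R p).weight.support) : ∃ x ∈ p.weight.support, x.2 = w := by
  classical
  exact Finset.mem_image.1 (mapVertices_mem_closedSimplex (exists_face_snd R) _
    (mem_closedSimplex_support p) hw)

theorem exists_of_mem_support_mark {p : (dowker (flip R)).Realization} {x : Finset V × W}
    (hx : x ∈ (mark R p).weight.support) : ∃ w ∈ p.weight.support, (∅, w) = x := by
  classical
  exact Finset.mem_image.1 (mapVertices_mem_closedSimplex (exists_face_mk_empty R) _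
    (mem_closedSimplex_support p) hx)

theorem mark_weight (p : (dowker (flip R)).Realization) (w : W) :
    (mark R p).weight (∅, w) = p.weight w :=
  Finsupp.mapDomain_apply (Prod.mk_right_injective ∅) p.weight w

theorem mark_weight_le {p : (dowker (flip R)).Realization} {w : W}
    (hw : ∀ u, p.weight u ≤ p.weight w) (x : Finset V × W) :
    (mark R p).weight x ≤ (mark R p).weight (∅, w) := by
  rw [mark_weight]
  by_cases hx : x ∈ (mark R p).weight.support
  · obtain ⟨u, -, rfl⟩ := exists_of_mem_support_mark hx
    rw [mark_weight]
    exact hw u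
  · rw [Finsupp.notMem_support_iff.1 hx]
    exact p.weight_nonneg w

/-- Marks do not affect the relation, so a vertex can be moved to the one with the same second
component and empty mark. -/
theorem mark_comp_unmark_homotopic_id (R : V → W → Prop) :
    ((mark R).comp (unmark R)).Homotopic (ContinuousMap.id _) := by
  classical
  refine homotopic_of_common_face ((isCarried_mark R).comp (isCarried_unmark R)) isCarried_id
    fun p => ?_
  obtain ⟨v, hv⟩ := p.support_mem.2
  refine ⟨(mark R (unmark R p)).weight.support ∪ p.weight.support, ⟨?_, v, fun x hx => ?_⟩,
    Finset.subset_union_left, Finset.subset_union_right⟩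
  · exact p.support_nonempty.mono Finset.subset_union_right
  · rcases Finset.mem_union.1 hx with hx | hx
    · obtain ⟨w, hw, rfl⟩ := exists_of_mem_support_mark hx
      obtain ⟨y, hy, rfl⟩ := exists_of_mem_support_unmark hw
      exact hv y hy
    · exact hv x hx

/-- For marked vertices the Dowker maps in both directions can be chosen such that the composite
does not enlarge supports: a set of marked vertices is sent to a vertex lying in all of its marks,
if this is possible. -/
theorem exists_isDowkerMap_marked (R : V → W → Prop) [Nonempty V] [Nonempty W] :
    ∃ (f : C((dowker R).Realization, (dowker (flip (markedRel R))).Realization))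
      (g : C((dowker (flip (markedRel R))).Realization, (dowker (markedRel R)).Realization)),
      IsDowkerMap (markedRel R) f ∧ IsDowkerMap (flip (markedRel R)) g ∧
      ∀ p, (g (f p)).weight.support ⊆ p.weight.support := by
  classical
  have h : ∀ s, s ∈ (dowker R).faces → ∃ w, ∀ v ∈ s, R v w := fun s hs => hs.2
  choose! φ hφ using h
  have h (C : Finset (Finset V × W)) : ∃ v,
      (C ∈ (dowker (flip (markedRel R))).faces → ∀ x ∈ C, R v x.2) ∧
      ((∃ u, ∀ x ∈ C, u ∈ x.1 ∧ R u x.2) → ∀ x ∈ C, v ∈ x.1) := by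
    by_cases hC : ∃ u, ∀ x ∈ C, u ∈ x.1 ∧ R u x.2
    -- a vertex as in `hC` serves both purposes at once
    · obtain ⟨u, hu⟩ := hC
      exact ⟨u, fun _ x hx => (hu x hx).2, fun _ x hx => (hu x hx).1⟩
    · by_cases hC' : C ∈ (dowker (flip (markedRel R))).faces
      · obtain ⟨u, hu⟩ := hC'.2
        exact ⟨u, fun _ => hu, fun h => absurd h hC⟩
      · exact ⟨Classical.arbitrary V, fun h => absurd h hC', fun h => absurd h hC⟩
  choose ψ hψ hψ' using h
  have hφ' : ∀ s ∈ (dowker R).faces, ∀ v ∈ s, markedRel R v (s, φ s) := hφ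
  have hψ'' : ∀ C ∈ (dowker (flip (markedRel R))).faces, ∀ x ∈ C, flip (markedRel R) x (ψ C) := hψ
  refine ⟨dowkerMap _ hφ', dowkerMap ψ hψ'', isDowkerMap_dowkerMap hφ',
    isDowkerMap_dowkerMap hψ'', fun p v hv => ?_⟩
  obtain ⟨C, hC, rfl⟩ := exists_of_mem_support_dowkerMap hψ'' hv
  -- the elements of `C` are faces of a chain, marked by themselves
  have hmark (x) (hx : x ∈ C) : x.1 ∈ (subdivide p).weight.support ∧ x = (x.1, φ x.1) := by
    obtain ⟨τ, hτ, rfl⟩ := exists_of_mem_support_dowkerMap hφ'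
      (subset_support_of_mem_subdivide hC hx)
    exact ⟨hτ, rfl⟩
  have hCne : C.Nonempty := ((subdivide _).support_mem.2.1 C hC).1
  have hD : C.image Prod.fst ∈ (subdivision (dowker R)).faces :=
    ((subdivision _).isRelLowerSet_faces (subdivide p).support_mem).2
      (Finset.image_subset_iff.2 fun x hx => (hmark x hx).1) (hCne.image _)
  obtain ⟨u, hu⟩ := exists_forall_mem_of_mem_subdivision hD
  have hmem := hψ' C ⟨u, fun x hx => by
    have hux := hu x.1 (Finset.mem_image_of_mem _ hx)
    refine ⟨hux, ?_⟩
    rw [(hmark x hx).2]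
    exact hφ x.1 ((subdivide p).support_mem.2.1 _ (hmark x hx).1) u hux⟩
  obtain ⟨x, hx⟩ := hCne
  exact subset_support_of_mem_subdivide (hmark x hx).1 (hmem x hx)

/-- Dowker maps in opposite directions are homotopy inverse to each other. Both are replaced by
Dowker maps that factor through the marked complex. -/
theorem IsDowkerMap.comp_homotopic_id
    {f : C((dowker R).Realization, (dowker (flip R)).Realization)}
    {g : C((dowker (flip R)).Realization, (dowker R).Realization)}
    (hf : IsDowkerMap R f) (hg : IsDowkerMap (flip R) g) :
    (g.comp f).Homotopic (ContinuousMap.id _) := by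
  rcases isEmpty_or_nonempty (dowker R).Realization with h | ⟨⟨p⟩⟩
  · rw [ContinuousMap.ext (f := g.comp f) (g := ContinuousMap.id _) fun p => isEmptyElim p]
  have : Nonempty V := p.support_nonempty.to_type
  have : Nonempty W := p.support_mem.2.nonempty
  obtain ⟨f', g', hf', hg', hgf⟩ := exists_isDowkerMap_marked R
  let i := inclusion (dowker_markedRel_le R)
  have hf₁ : IsDowkerMap R ((unmark R).comp f') :=
    { isCarried := (isCarried_unmark R).comp hf'.isCarried
      rel := fun p v w hv hw => by
        obtain ⟨x, hx, rfl⟩ := exists_of_mem_support_unmark hw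
        exact hf'.rel p v x hv hx }
  have hg₁ : IsDowkerMap (flip R) ((i.comp g').comp (mark R)) :=
    { isCarried :=
        ((isCarried_inclusion (dowker_markedRel_le R)).comp hg'.isCarried).comp (isCarried_mark R)
      rel := fun p w v hw hv => hg'.rel (mark R p) (∅, w) v (mark_weight_le hw) hv }
  have h₁ : (g.comp f).Homotopic (((i.comp g').comp (mark R)).comp ((unmark R).comp f')) :=
    (hg.homotopic hg₁).comp (hf.homotopic hf₁)
  have h₂ : ((i.comp g').comp (((mark R).comp (unmark R)).comp f')).Homotopic
      ((i.comp g').comp ((ContinuousMap.id _).comp f')) :=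
    (ContinuousMap.Homotopic.refl _).comp
      ((mark_comp_unmark_homotopic_id R).comp (ContinuousMap.Homotopic.refl _))
  have h₃ : ((i.comp g').comp f').Homotopic (ContinuousMap.id _) :=
    homotopic_of_common_face
      (((isCarried_inclusion (dowker_markedRel_le R)).comp hg'.isCarried).comp hf'.isCarried)
      isCarried_id fun p => ⟨_, p.support_mem, hgf p, mem_closedSimplex_support p⟩
  exact h₁.trans (h₂.trans h₃)

/-! ### Functorial Dowker duality -/

/-- Any Dowker map is a homotopy equivalence, since the composites of Dowker maps in opposite
directions are homotopic to the identity. -/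
theorem exists_homotopyEquiv_isDowkerMap (R : V → W → Prop) :
    ∃ e : ContinuousMap.HomotopyEquiv (dowker R).Realization (dowker (flip R)).Realization,
      IsDowkerMap R e.toFun := by
  obtain ⟨f, hf⟩ := exists_isDowkerMap R
  obtain ⟨g, hg⟩ := exists_isDowkerMap (flip R)
  exact ⟨⟨f, g, hf.comp_homotopic_id hg, hg.comp_homotopic_id hf⟩, hf⟩

/-- Functorial Dowker duality, for complexes that are only propositionally equal to the Dowker
complexes. -/
theorem exists_homotopyEquiv_natural {R R' : V → W → Prop} {K K' : PreAbstractSimplicialComplex V}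
    {L L' : PreAbstractSimplicialComplex W} (hK : K = dowker R) (hK' : K' = dowker R')
    (hL : L = dowker (flip R)) (hL' : L' = dowker (flip R')) (hR : ∀ v w, R v w → R' v w)
    (i : K ≤ K') (j : L ≤ L') :
    ∃ (e : ContinuousMap.HomotopyEquiv K.Realization L.Realization)
      (e' : ContinuousMap.HomotopyEquiv K'.Realization L'.Realization),
      ((inclusion j).comp e.toFun).Homotopic (e'.toFun.comp (inclusion i)) := by
  subst hK hK' hL hL'
  obtain ⟨e, he⟩ := exists_homotopyEquiv_isDowkerMap R
  obtain ⟨e', he'⟩ := exists_homotopyEquiv_isDowkerMap R'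
  refine ⟨e, e', IsDowkerMap.homotopic (R := R') ⟨?_, ?_⟩ ⟨?_, ?_⟩⟩
  · exact (isCarried_inclusion j).comp he.isCarried
  · exact fun p v w hv hw => hR v w (he.rel p v w hv hw)
  · exact he'.isCarried.comp (isCarried_inclusion i)
  · exact fun p v w hv hw => he'.rel (inclusion i p) v w hv hw

end PreAbstractSimplicialComplex

/-! ### Čech complexes -/

/-- The Čech complexes of a pair are the two Dowker complexes of the relation of closeness. -/
theorem cechComplex_eq_dowker {M : Type*} [MetricSpace M] (Y X : Set M) (α : ℝ) :
    cechComplex Y X α =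
      PreAbstractSimplicialComplex.dowker fun x y => x ∈ X ∧ y ∈ Y ∧ dist x y < α := by
  refine PreAbstractSimplicialComplex.ext (Set.ext fun s => ⟨?_, ?_⟩)
  · rintro ⟨hs, hX, y, hy, h⟩
    exact ⟨hs, y, fun x hx => ⟨hX hx, hy, h x hx⟩⟩
  · rintro ⟨⟨x, hx⟩, y, h⟩
    exact ⟨⟨x, hx⟩, fun z hz => (h z hz).1, y, (h x hx).2.1, fun z hz => (h z hz).2.2⟩

theorem cechComplex_eq_dowker_flip {M : Type*} [MetricSpace M] (Y X : Set M) (α : ℝ) :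
    cechComplex X Y α =
      PreAbstractSimplicialComplex.dowker
        (flip fun x y => x ∈ X ∧ y ∈ Y ∧ dist x y < α) := by
  rw [cechComplex_eq_dowker]
  congr! 3 with y x
  simp only [flip, dist_comm]
  tauto

theorem theorem3p1 {M : Type*} [MetricSpace M] (A B X Y : Set M) (β α : ℝ)
    (hβ : 0 < β) (hβα : β ≤ α) (hsub : A ×ˢ B ⊆ X ×ˢ Y) :
    ∃ (Γ : ContinuousMap.HomotopyEquiv
          (cechComplex B A β).Realization (cechComplex A B β).Realization)
      (Δ : ContinuousMap.HomotopyEquiv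
          (cechComplex Y X α).Realization (cechComplex X Y α).Realization),
      ContinuousMap.Homotopic
        ((PreAbstractSimplicialComplex.Realization.inclusion
          (cechComplex_mono_swap hβα hsub)).comp Γ.toFun)
        (Δ.toFun.comp
          (PreAbstractSimplicialComplex.Realization.inclusion (cechComplex_mono hβα hsub))) := by
  exact PreAbstractSimplicialComplex.exists_homotopyEquiv_natural
    (cechComplex_eq_dowker B A β) (cechComplex_eq_dowker Y X α)
    (cechComplex_eq_dowker_flip B A β) (cechComplex_eq_dowker_flip Y X α)
    (fun x y ⟨hx, hy, h⟩ => ⟨(hsub (Set.mk_mem_prod hx hy)).1, (hsub (Set.mk_mem_prod hx hy)).2,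
      h.trans_le hβα⟩) _ _
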